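/- Let $K \ge 2$ and let $\nu_1,\dots,\nu_K$ be probability distributions on $[-R_{\max}, R_{\max}]$ for some $R_{\max} > 0$ (the reward distributions of the $K$ arms), with means $r(a) = \int x \, \nu_a(dx)$. Assume that there are no ties: $r(i) \ne r(j)$ whenever $i \ne j$. Let $a^* = \operatorname{argmax}_{a \in [K]} r(a)$ be the optimal arm. For $\theta \in \mathbb{R}^K$ let $\pi_\theta(a) = e^{\theta(a)} / \sum_{b \in [K]} e^{\theta(b)}$. Let $\eta > 0$ be an arbitrary constant learning rate and consider the gradient bandit algorithm: it starts from an arbitrary (deterministic or random) $\theta_1 \in \mathbb{R}^K$, and in each iteration $t \ge 1$, given the past (that is, $\theta_1$ and the arms and rewards of the iterations before $t$), it samples an arm $a_t \sim \pi_{\theta_t}(\cdot)$, then observes a reward $R_t \sim \nu_{a_t}$, and sets $$\theta_{t+1}(a) = \begin{cases} \theta_t(a) + \eta \, (1 - \pi_{\theta_t}(a)) \, R_t, & a = a_t, \\ \theta_t(a) - \eta \, \pi_{\theta_t}(a) \, R_t, & a \ne a_t, \end{cases} \qquad a \in [K].$$ Then, almost surely, $\pi_{\theta_t}(a^*) \to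 1$ as $t \to \infty$. -/

import Mathlib

open MeasureTheory ProbabilityTheory Filter Topology

/-- The softmax policy `π_θ` on `K` arms with parameter vector `θ`. -/
noncomputable def softmax {K : ℕ} (θ : Fin K → ℝ) (a : Fin K) : ℝ :=
  Real.exp (θ a) / ∑ b : Fin K, Real.exp (θ b)

/-- The true mean reward `r(a)` of arm `a`, whose reward distribution is `ν a`. -/
noncomputable def meanReward {K : ℕ} (ν : Fin K → Measure ℝ) (a : Fin K) : ℝ :=
  ∫ x, x ∂(ν a)

/-- One update of the gradient bandit algorithm with learning rate `η`, from parameters `θ`,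
after pulling arm `b` and observing the reward `x`. -/
noncomputable def gradientBanditUpdate {K : ℕ} (η : ℝ) (θ : Fin K → ℝ) (b : Fin K) (x : ℝ) :
    Fin K → ℝ :=
  fun a => if a = b then θ a + η * (1 - softmax θ a) * x else θ a - η * softmax θ a * x

/-- `θ`, `A`, `R` are the parameters, pulled arms and observed rewards of a run of the gradient
bandit algorithm with learning rate `η` on the bandit with reward distributions `ν`. Iterations are
numbered from `0`, so `θ 0` is the (arbitrary, possibly random) initialization. The σ-algebra `ℱ t`
contains the information available before the `t`-th pull. -/
structure IsGradientBanditRun {Ω : Type*} {mΩ : MeasurableSpace Ω} (P : Measure Ω)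
    (ℱ : Filtration ℕ mΩ) {K : ℕ} (ν : Fin K → Measure ℝ) (η : ℝ)
    (θ : ℕ → Ω → Fin K → ℝ) (A : ℕ → Ω → Fin K) (R : ℕ → Ω → ℝ) : Prop where
  /-- The initialization is known at the start. -/
  measurable_init : Measurable[ℱ 0] (θ 0)
  /-- The arm pulled in an iteration is known after it. -/
  measurable_arm : ∀ t, Measurable[ℱ (t + 1)] (A t)
  /-- The reward observed in an iteration is known after it. -/
  measurable_reward : ∀ t, Measurable[ℱ (t + 1)] (R t)
  /-- Given the past, the arm is drawn from the softmax policy and then the reward is drawn from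
  the reward distribution of that arm. -/
  condLaw : ∀ (t : ℕ) (a : Fin K) (B : Set ℝ), MeasurableSet B →
    P[({ω | A t ω = a ∧ R t ω ∈ B}).indicator (fun _ => (1 : ℝ)) | ℱ t]
      =ᵐ[P] fun ω => softmax (θ t ω) a * (ν a).real B
  /-- The parameters are updated by the gradient bandit rule. -/
  update : ∀ t ω, θ (t + 1) ω = gradientBanditUpdate η (θ t ω) (A t ω) (R t ω)

/-! Let V_t(a) be the sum over s < t of π_s(a)(1 − π_s(a)); up to a constant it bounds the
accumulated conditional variance of θ_t(a). An exponential supermartingale with a small parameter l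
shows that, almost surely, each coordinate deviates from its accumulated drift by at most C + ε
V_t(a), for every ε > 0 (`ae_followsDrift`). Only l has to be small, so η is arbitrary.

The rest is deterministic. The drift of an arm is η π(a) times its advantage. If the arms better
than a, or those worse than a, carry negligible mass, the advantage has a fixed sign and size at
least a multiple of 1 − π(a), so the drift dominates the noise.

No arm has summable probabilities (`FollowsDrift.not_summable`): such an arm has its parameter
bounded below, whereas the worst of the arms with non-summable probabilities has its parameter
bounded above, hence probabilities dominated by a summable sequence.

For the optimal arm, if V_t stays bounded then π_t tends to 1, since the alternative would make π_t
summable. Otherwise its parameter tends to infinity, and induction from the worst arm upwards bounds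
every other parameter above (`FollowsDrift.tendsto_softmax`). -/

/-! ### Softmax identities and inequalities. -/

section Softmax

variable {K : ℕ} (x : Fin K → ℝ)

lemma sum_exp_pos (a : Fin K) : 0 < ∑ b : Fin K, Real.exp (x b) :=
  Finset.sum_pos (fun _ _ => Real.exp_pos _) ⟨a, Finset.mem_univ a⟩

lemma softmax_pos (a : Fin K) : 0 < softmax x a :=
  div_pos (Real.exp_pos _) (sum_exp_pos x a)

lemma sum_softmax (a : Fin K) : ∑ b, softmax x b = 1 := by
  simp only [softmax, ← Finset.sum_div]
  exact div_self (sum_exp_pos x a).ne'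

lemma softmax_le_one (a : Fin K) : softmax x a ≤ 1 := by
  rw [← sum_softmax x a]
  exact Finset.single_le_sum (fun b _ => (softmax_pos x b).le) (Finset.mem_univ a)

lemma softmax_eq_exp_sub_mul (a b : Fin K) :
    softmax x a = Real.exp (x a - x b) * softmax x b := by
  rw [softmax, softmax, Real.exp_sub]
  field_simp

lemma one_sub_softmax (a : Fin K) :
    1 - softmax x a = ∑ b ∈ Finset.univ.erase a, softmax x b := by
  rw [← sum_softmax x a, ← Finset.add_sum_erase _ _ (Finset.mem_univ a)]
  ring

/-- Moving every coordinate by at most `B` changes each softmax weight by at most a constant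
factor. -/
lemma softmax_le_exp_mul (y : Fin K → ℝ) {B : ℝ} (h : ∀ b, |y b - x b| ≤ B) (a : Fin K) :
    softmax y a ≤ Real.exp (2 * B) * softmax x a := by
  have hx := sum_exp_pos x a
  have hy := sum_exp_pos y a
  have h1 : Real.exp (y a) ≤ Real.exp B * Real.exp (x a) := by
    rw [← Real.exp_add, Real.exp_le_exp]
    linarith [le_abs_self (y a - x a), h a]
  have h2 : ∑ b, Real.exp (x b) ≤ Real.exp B * ∑ b, Real.exp (y b) := by
    rw [Finset.mul_sum]
    refine Finset.sum_le_sum fun b _ => ?_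
    rw [← Real.exp_add, Real.exp_le_exp]
    linarith [neg_abs_le (y b - x b), h b]
  rw [softmax, softmax, ← mul_div_assoc, div_le_div_iff₀ hy hx, two_mul, Real.exp_add]
  calc _ ≤ (Real.exp B * Real.exp (x a)) * (Real.exp B * ∑ b, Real.exp (y b)) := by gcongr
    _ = _ := by ring

lemma sub_sum_softmax_mul (r : Fin K → ℝ) (a : Fin K) :
    r a - ∑ b, softmax x b * r b = ∑ b ∈ Finset.univ.erase a, softmax x b * (r a - r b) := by
  have h : ∑ b, softmax x b * (r a - r b) = r a - ∑ b, softmax x b * r b := by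
    simp only [mul_sub, Finset.sum_sub_distrib, ← Finset.sum_mul, sum_softmax x a, one_mul]
  rw [← h, ← Finset.add_sum_erase _ _ (Finset.mem_univ a)]
  simp

lemma softmax_mul_one_sub_nonneg (a : Fin K) : 0 ≤ softmax x a * (1 - softmax x a) :=
  mul_nonneg (softmax_pos _ _).le (sub_nonneg.2 (softmax_le_one _ _))

end Softmax

/-! ### Deterministic analysis of paths that follow their drift. -/

/-- A process that is controlled by its drift `d` up to a small multiple of `v` follows the drift,
if the latter is at most `-2ε v` up to a summable error. -/
lemma exists_le_sub_of_drift_le {y d v g : ℕ → ℝ} {ε C : ℝ}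
    (hy : ∀ t, y t ≤ C + ε * ∑ s ∈ Finset.range t, v s + ∑ s ∈ Finset.range t, d s)
    (hg : Summable g) (hd : ∀ᶠ t in atTop, d t ≤ -(2 * ε) * v t + g t) :
    ∃ E, ∀ t, y t ≤ E - ε * ∑ s ∈ Finset.range t, v s := by
  obtain ⟨T, hT⟩ := eventually_atTop.1 hd
  -- `e` is nonpositive from time `T` on, so its partial sums are bounded above. Of the drift −2ε v,
  -- one half pays for the noise.
  set e : ℕ → ℝ := fun t => d t + 2 * ε * v t - g t
  have he : ∃ E, ∀ t, ∑ s ∈ Finset.range t, e s ≤ E := by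
    refine ⟨∑ s ∈ Finset.range T, |e s|, fun t => ?_⟩
    calc ∑ s ∈ Finset.range t, e s ≤ ∑ s ∈ Finset.range t, if s < T then |e s| else 0 := by
          refine Finset.sum_le_sum fun s _ => ?_
          split_ifs with h
          · exact le_abs_self _
          · have := hT s (not_lt.1 h)
            simp only [e]
            linarith
      _ = ∑ s ∈ (Finset.range t).filter (· < T), |e s| := (Finset.sum_filter _ _).symm
      _ ≤ _ := by
          refine Finset.sum_le_sum_of_subset_of_nonneg (fun s hs => ?_)
            fun _ _ _ => abs_nonneg _
          simpa using (Finset.mem_filter.1 hs).2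
  obtain ⟨E, hE⟩ := he
  obtain ⟨G, hG⟩ := hg.hasSum.tendsto_sum_nat.bddAbove_range
  refine ⟨C + E + G, fun t => ?_⟩
  have h1 := hy t
  have h2 := hE t
  have h3 : ∑ s ∈ Finset.range t, g s ≤ G := hG ⟨t, rfl⟩
  simp only [e, Finset.sum_add_distrib, Finset.sum_sub_distrib, ← Finset.mul_sum] at h2
  linarith

section Path

variable {K : ℕ} {η : ℝ} {r : Fin K → ℝ} {x : ℕ → Fin K → ℝ}

/-- The path `x` follows the drift of the gradient bandit algorithm with mean rewards `r`, up to
an arbitrarily small multiple of the accumulated variance of each coordinate. -/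
def FollowsDrift (η : ℝ) (r : Fin K → ℝ) (x : ℕ → Fin K → ℝ) : Prop :=
  ∀ a, ∀ ε > 0, ∃ C, ∀ t, |x t a - ∑ s ∈ Finset.range t,
    η * (softmax (x s) a * (r a - ∑ b, softmax (x s) b * r b))| ≤
      C + ε * ∑ s ∈ Finset.range t, softmax (x s) a * (1 - softmax (x s) a)

/-- There are finitely many pairs of arms, so a uniform gap exists; it turns the sign of an
advantage into a multiple of 1 − π(a). -/
lemma exists_gap (r : Fin K → ℝ) : ∃ c > 0, ∀ i j, r i < r j → c ≤ r j - r i := by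
  have h : ∀ᶠ c in 𝓝[>] (0 : ℝ), ∀ i j, r i < r j → c ≤ r j - r i := by
    simp only [eventually_all]
    intro i j hij
    exact nhdsWithin_le_nhds (eventually_le_nhds (sub_pos.2 hij))
  exact (eventually_mem_nhdsWithin.and h).exists

lemma FollowsDrift.upper (h : FollowsDrift η r x) (hη : 0 < η) {a : Fin K} {c : ℝ} (hc : 0 < c)
    {g : ℕ → ℝ} (hg : Summable g)
    (hd : ∀ᶠ t in atTop, softmax (x t) a * (r a - ∑ b, softmax (x t) b * r b) ≤
      -c * (softmax (x t) a * (1 - softmax (x t) a)) + g t) :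
    ∃ C, ∀ t, x t a ≤ C := by
  obtain ⟨C, hC⟩ := h a (η * c / 2) (by positivity)
  obtain ⟨E, hE⟩ := exists_le_sub_of_drift_le (y := fun t => x t a)
    (d := fun s => η * (softmax (x s) a * (r a - ∑ b, softmax (x s) b * r b)))
    (v := fun s => softmax (x s) a * (1 - softmax (x s) a)) (ε := η * c / 2) (C := C)
    (fun t => by linarith [le_abs_self (x t a - ∑ s ∈ Finset.range t,
      η * (softmax (x s) a * (r a - ∑ b, softmax (x s) b * r b))), hC t])
    (hg.mul_left η) (hd.mono fun t ht => by
      have := mul_le_mul_of_nonneg_left ht hη.le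
      linarith)
  refine ⟨E, fun t => (hE t).trans (sub_le_self _ (mul_nonneg (by positivity) ?_))⟩
  exact Finset.sum_nonneg fun s _ => softmax_mul_one_sub_nonneg _ _

/-- Taking ε = ηc/2 leaves half of the drift. The variance sum is kept because its divergence forces
the parameter to infinity. -/
lemma FollowsDrift.lower (h : FollowsDrift η r x) (hη : 0 < η) {a : Fin K} {c : ℝ} (hc : 0 < c)
    {g : ℕ → ℝ} (hg : Summable g)
    (hd : ∀ᶠ t in atTop, c * (softmax (x t) a * (1 - softmax (x t) a)) - g t ≤
      softmax (x t) a * (r a - ∑ b, softmax (x t) b * r b)) :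
    ∃ C, ∀ t, C + η * c / 2 * ∑ s ∈ Finset.range t, softmax (x s) a * (1 - softmax (x s) a)
      ≤ x t a := by
  obtain ⟨C, hC⟩ := h a (η * c / 2) (by positivity)
  obtain ⟨E, hE⟩ := exists_le_sub_of_drift_le (y := fun t => -x t a)
    (d := fun s => -(η * (softmax (x s) a * (r a - ∑ b, softmax (x s) b * r b))))
    (v := fun s => softmax (x s) a * (1 - softmax (x s) a)) (ε := η * c / 2) (C := C)
    (fun t => by
      rw [Finset.sum_neg_distrib]
      linarith [neg_abs_le (x t a - ∑ s ∈ Finset.range t,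
        η * (softmax (x s) a * (r a - ∑ b, softmax (x s) b * r b))), hC t])
    (hg.mul_left η) (hd.mono fun t ht => by
      have := mul_le_mul_of_nonneg_left ht hη.le
      linarith)
  exact ⟨-E, fun t => by linarith [hE t]⟩

/-- The advantage of an arm is bounded by the spread of the rewards. -/
lemma abs_sub_sum_softmax_mul_le {D : ℝ} (hD : ∀ i j, |r i - r j| ≤ D) (y : Fin K → ℝ)
    (a : Fin K) : |r a - ∑ b, softmax y b * r b| ≤ D * (1 - softmax y a) := by
  rw [sub_sum_softmax_mul, one_sub_softmax, Finset.mul_sum]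
  refine (Finset.abs_sum_le_sum_abs _ _).trans (Finset.sum_le_sum fun b _ => ?_)
  rw [abs_mul, abs_of_pos (softmax_pos _ _), mul_comm]
  exact mul_le_mul_of_nonneg_right (hD _ _) (softmax_pos _ _).le

lemma exists_spread (r : Fin K → ℝ) : ∃ D ≥ 0, ∀ i j, |r i - r j| ≤ D := by
  refine ⟨∑ q : Fin K × Fin K, |r q.1 - r q.2|, by positivity, fun i j => ?_⟩
  exact Finset.single_le_sum (f := fun q : Fin K × Fin K => |r q.1 - r q.2|)
    (fun _ _ => abs_nonneg _) (Finset.mem_univ (i, j))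

/-- No arm has summable probabilities. -/
lemma FollowsDrift.not_summable (h : FollowsDrift η r x) (hη : 0 < η)
    (hr : Function.Injective r) (a₀ : Fin K) : ¬ Summable fun t => softmax (x t) a₀ := by
  classical
  intro h₀
  obtain ⟨c, hc, hgap⟩ := exists_gap r
  obtain ⟨D, hD0, hD⟩ := exists_spread r
  -- The drift of `a₀` is at least −ηDπ, and π(1 − π) − (D + 1)π ≤ −Dπ, so `lower` applies with gap
  -- constant 1 and a summable error.
  have hlow : ∃ C, ∀ t, C ≤ x t a₀ := by
    obtain ⟨C, hC⟩ := h.lower hη (a := a₀) one_pos (h₀.mul_left (D + 1))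
      (Eventually.of_forall fun t => by
        have h1 := (abs_le.1 (abs_sub_sum_softmax_mul_le hD (x t) a₀)).1
        have h2 := softmax_pos (x t) a₀
        have h3 := softmax_le_one (x t) a₀
        have h4 : D * (1 - softmax (x t) a₀) ≤ D := by nlinarith
        have h5 := mul_le_mul_of_nonneg_left (h4.trans' (neg_le.1 h1)) h2.le
        nlinarith)
    refine ⟨C, fun t => (hC t).trans' (le_add_of_nonneg_right (mul_nonneg (by positivity) ?_))⟩
    exact Finset.sum_nonneg fun s _ => softmax_mul_one_sub_nonneg _ _
  obtain ⟨C₀, hC₀⟩ := hlow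
  set N : Finset (Fin K) := Finset.univ.filter fun a => Summable fun t => softmax (x t) a with hN
  have hne : Nᶜ.Nonempty := by
    by_contra hne
    rw [Finset.not_nonempty_iff_eq_empty, Finset.compl_eq_empty_iff] at hne
    have hs : Summable fun t => ∑ a, softmax (x t) a := summable_sum fun a _ => by
      have := Finset.mem_univ a
      rw [← hne, hN, Finset.mem_filter] at this
      exact this.2
    simp only [sum_softmax _ a₀] at hs
    simp [summable_const_iff] at hs
  -- Every arm better or worse than `i` either beats it by `c` or lies in `N`. An arm of `N`
  -- contributes at most Dπ(b) = −cπ(b) + (D + c)π(b), whence the factor `D + c`.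
  obtain ⟨i, hi, hmin⟩ := Nᶜ.exists_min_image r hne
  have hgs : Summable fun t => (D + c) * ∑ b ∈ N, softmax (x t) b :=
    (summable_sum fun b hb => (Finset.mem_filter.1 hb).2).mul_left _
  obtain ⟨C₁, hC₁⟩ := h.upper hη (a := i) hc hgs (Eventually.of_forall fun t => by
    have key : r i - ∑ b, softmax (x t) b * r b ≤
        -c * (1 - softmax (x t) i) + (D + c) * ∑ b ∈ N, softmax (x t) b := by
      have hNi : N = (Finset.univ.erase i).filter (· ∈ N) := by
        ext b
        simp only [Finset.mem_filter, Finset.mem_erase, Finset.mem_univ, and_true]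
        refine ⟨fun hb => ⟨?_, hb⟩, fun hb => hb.2⟩
        rintro rfl
        exact Finset.mem_compl.1 hi hb
      rw [hNi, Finset.sum_filter, sub_sum_softmax_mul, one_sub_softmax, Finset.mul_sum,
        Finset.mul_sum, ← Finset.sum_add_distrib]
      refine Finset.sum_le_sum fun b hb => ?_
      have hp := softmax_pos (x t) b
      split_ifs with hbN
      · nlinarith [(abs_le.1 (hD i b)).2]
      · have hlt : r i < r b := lt_of_le_of_ne (hmin b (Finset.mem_compl.2 hbN))
          fun e => (Finset.mem_erase.1 hb).1 (hr e).symm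
        nlinarith [hgap i b hlt]
    have h2 := softmax_pos (x t) i
    have h3 := softmax_le_one (x t) i
    have h4 : 0 ≤ (D + c) * ∑ b ∈ N, softmax (x t) b :=
      mul_nonneg (by positivity) (Finset.sum_nonneg fun b _ => (softmax_pos _ _).le)
    have h5 := mul_le_mul_of_nonneg_left key h2.le
    nlinarith)
  refine Finset.mem_compl.1 hi (Finset.mem_filter.2 ⟨Finset.mem_univ i, ?_⟩)
  refine Summable.of_nonneg_of_le (fun t => (softmax_pos _ _).le) (fun t => ?_)
    (h₀.mul_left (Real.exp (C₁ - C₀)))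
  rw [softmax_eq_exp_sub_mul (x t) i a₀]
  have := softmax_pos (x t) a₀
  gcongr
  · exact hC₁ t
  · exact hC₀ t

/-- A sequence in `[0, 1]` that grows by at most a constant factor per step and has divergent sum
tends to `1` as soon as `∑ p (1 - p)` converges. -/
lemma tendsto_one_of_summable_variance {p : ℕ → ℝ} (h0 : ∀ t, 0 ≤ p t)
    {M : ℝ} (hM : 0 < M) (hstep : ∀ t, p (t + 1) ≤ M * p t) (hp : ¬ Summable p)
    (hv : Summable fun t => p t * (1 - p t)) (h1 : ∀ t, p t ≤ 1) : Tendsto p atTop (𝓝 1) := by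
  have hlim := hv.tendsto_atTop_zero
  -- While p < 1/2, p ≤ 2p(1 − p) < 1/(2M), so the next value is again below 1/2. A late value below
  -- 1/2 thus traps the sequence there, and p ≤ 2p(1 − p) makes it summable.
  obtain ⟨T, hT⟩ := eventually_atTop.1 (hlim.eventually (gt_mem_nhds
    (show (0 : ℝ) < 1 / (4 * M) by positivity)))
  have hlarge : ∀ t ≥ T, 1 / 2 ≤ p t := by
    intro t ht
    by_contra! hlt
    have hsmall : ∀ n, p (n + t) < 1 / 2 := by
      intro n
      induction n with
      | zero => simpa using hlt
      | succ n ih =>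
        have h2 := hT (n + t) (by omega)
        have h3 := hstep (n + t)
        have h4 : p (n + t) < 1 / (2 * M) := by
          have : 1 / (2 * M) = 2 * (1 / (4 * M)) := by field_simp; norm_num
          rw [this]
          nlinarith [h0 (n + t)]
        have h5 : M * p (n + t) < 1 / 2 := by
          calc M * p (n + t) < M * (1 / (2 * M)) := by gcongr
            _ = 1 / 2 := by field_simp
        rw [show n + 1 + t = n + t + 1 by ring]
        linarith
    refine hp ((summable_nat_add_iff t).1 ?_)
    refine Summable.of_nonneg_of_le (fun n => h0 _) (fun n => ?_)
      (((summable_nat_add_iff t).2 hv).mul_left 2)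
    nlinarith [h0 (n + t), hsmall n]
  have hsub : Tendsto (fun t => 1 - p t) atTop (𝓝 0) := by
    refine tendsto_of_tendsto_of_tendsto_of_le_of_le' tendsto_const_nhds
      (by simpa using hlim.const_mul 2) (Eventually.of_forall fun t => sub_nonneg.2 (h1 t)) ?_
    filter_upwards [eventually_ge_atTop T] with t ht
    nlinarith [hlarge t ht, h1 t]
  simpa using hsub.const_sub 1

theorem FollowsDrift.tendsto_softmax (h : FollowsDrift η r x) (hη : 0 < η)
    (hr : Function.Injective r) {B : ℝ} (hB : ∀ t a, |x (t + 1) a - x t a| ≤ B)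
    {a₁ : Fin K} (ha₁ : ∀ a, r a ≤ r a₁) :
    Tendsto (fun t => softmax (x t) a₁) atTop (𝓝 1) := by
  by_cases hv : Summable fun t => softmax (x t) a₁ * (1 - softmax (x t) a₁)
  · exact tendsto_one_of_summable_variance (fun t => (softmax_pos _ _).le) (Real.exp_pos (2 * B))
      (fun t => softmax_le_exp_mul _ _ (hB t) a₁) (h.not_summable hη hr a₁) hv
      fun t => softmax_le_one _ _
  obtain ⟨c, hc, hgap⟩ := exists_gap r
  obtain ⟨D, hD0, hD⟩ := exists_spread r
  -- All other arms are worse by at least `c`, so the drift of `a₁` is at least ηc times its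
  -- variance term, whose sum diverges.
  have htop : Tendsto (fun t => x t a₁) atTop atTop := by
    obtain ⟨C, hC⟩ := h.lower hη (a := a₁) hc (g := fun _ => 0) summable_zero
      (Eventually.of_forall fun t => by
        rw [sub_sum_softmax_mul, one_sub_softmax, mul_left_comm, sub_zero]
        refine mul_le_mul_of_nonneg_left ?_ (softmax_pos _ _).le
        rw [Finset.mul_sum]
        refine Finset.sum_le_sum fun b hb => ?_
        have hlt : r b < r a₁ := lt_of_le_of_ne (ha₁ b) fun e => (Finset.mem_erase.1 hb).1 (hr e)
        rw [mul_comm]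
        exact mul_le_mul_of_nonneg_left (hgap _ _ hlt) (softmax_pos _ _).le)
    refine tendsto_atTop_mono hC (tendsto_atTop_add_const_left _ _ ?_)
    refine Tendsto.const_mul_atTop (by positivity) ?_
    exact (not_summable_iff_tendsto_nat_atTop_of_nonneg fun t => softmax_mul_one_sub_nonneg _ _).1 hv
  have hratio : ∀ a, a ≠ a₁ → Tendsto (fun t => Real.exp (x t a - x t a₁)) atTop (𝓝 0) := by
    intro a
    induction a using (Finite.wellFounded_of_trans_of_irrefl
      (InvImage (· < ·) r : Fin K → Fin K → Prop)).induction with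
    | _ a ih =>
    intro ha
    obtain ⟨C, hC⟩ : ∃ C, ∀ t, x t a ≤ C := by
      -- The threshold makes (D + c) times the mass of the arms worse than `a` at most (c/2)(1 −
      -- π(a)): that mass is small relative to π(a₁), and π(a₁) ≤ 1 − π(a).
      have hε : ∀ᶠ t in atTop, ∑ b ∈ Finset.univ.filter (fun b => r b < r a),
          Real.exp (x t b - x t a₁) < c / (2 * (D + c)) := by
        have hlim : Tendsto (fun t => ∑ b ∈ Finset.univ.filter (fun b => r b < r a),
            Real.exp (x t b - x t a₁)) atTop (𝓝 0) := by
          rw [← Finset.sum_const_zero (ι := Fin K)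
            (s := Finset.univ.filter (fun b => r b < r a))]
          refine tendsto_finsetSum _ fun b hb => ih b (Finset.mem_filter.1 hb).2 ?_
          rintro rfl
          exact absurd (Finset.mem_filter.1 hb).2 (not_lt.2 (ha₁ a))
        exact hlim.eventually (gt_mem_nhds (by positivity))
      refine h.upper hη (a := a) (c := c / 2) (by positivity) (g := fun _ => 0) summable_zero ?_
      filter_upwards [hε] with t ht
      rw [add_zero, mul_left_comm]
      refine mul_le_mul_of_nonneg_left ?_ (softmax_pos _ _).le
      have hbad : ∑ b ∈ Finset.univ.filter (fun b => r b < r a), softmax (x t) b ≤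
          c / (2 * (D + c)) * (1 - softmax (x t) a) := by
        have h1 : softmax (x t) a₁ ≤ 1 - softmax (x t) a := by
          rw [one_sub_softmax]
          exact Finset.single_le_sum (fun b _ => (softmax_pos (x t) b).le)
            (Finset.mem_erase.2 ⟨ha.symm, Finset.mem_univ _⟩)
        calc _ = (∑ b ∈ Finset.univ.filter (fun b => r b < r a), Real.exp (x t b - x t a₁)) *
              softmax (x t) a₁ := by
              rw [Finset.sum_mul]
              exact Finset.sum_congr rfl fun b _ => softmax_eq_exp_sub_mul _ _ _
          _ ≤ _ := mul_le_mul ht.le h1 (softmax_pos _ _).le (by positivity)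
      have hsum : r a - ∑ b, softmax (x t) b * r b ≤ -c * (1 - softmax (x t) a) +
          (D + c) * ∑ b ∈ Finset.univ.filter (fun b => r b < r a), softmax (x t) b := by
        have hfil : Finset.univ.filter (fun b => r b < r a) =
            (Finset.univ.erase a).filter (fun b => r b < r a) := by
          ext b
          simp only [Finset.mem_filter, Finset.mem_erase, Finset.mem_univ, and_true, true_and]
          refine ⟨fun hb => ⟨?_, hb⟩, fun hb => hb.2⟩
          rintro rfl
          exact lt_irrefl _ hb
        rw [hfil, Finset.sum_filter, sub_sum_softmax_mul, one_sub_softmax, Finset.mul_sum,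
          Finset.mul_sum, ← Finset.sum_add_distrib]
        refine Finset.sum_le_sum fun b hb => ?_
        have hp := softmax_pos (x t) b
        split_ifs with hlt
        · nlinarith [(abs_le.1 (hD a b)).2]
        · have hlt' : r a < r b := lt_of_le_of_ne (not_lt.1 hlt)
            fun e => (Finset.mem_erase.1 hb).1 (hr e).symm
          nlinarith [hgap a b hlt']
      have h2 := mul_le_mul_of_nonneg_left hbad (by positivity : 0 ≤ D + c)
      have h3 : (D + c) * (c / (2 * (D + c)) * (1 - softmax (x t) a)) =
          c / 2 * (1 - softmax (x t) a) := by
        field_simp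
      linarith
    refine Real.tendsto_exp_atBot.comp (tendsto_atBot_mono (fun t => ?_)
      (tendsto_atBot_add_const_left _ C (tendsto_neg_atTop_atBot.comp htop)))
    simp only [Function.comp]
    linarith [hC t]
  have hsub : Tendsto (fun t => 1 - softmax (x t) a₁) atTop (𝓝 0) := by
    have hlim : Tendsto (fun t => ∑ b ∈ Finset.univ.erase a₁, Real.exp (x t b - x t a₁))
        atTop (𝓝 0) := by
      rw [← Finset.sum_const_zero (ι := Fin K) (s := Finset.univ.erase a₁)]
      exact tendsto_finsetSum _ fun b hb => hratio b (Finset.mem_erase.1 hb).1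
    refine squeeze_zero (fun t => sub_nonneg.2 (softmax_le_one _ _)) (fun t => ?_) hlim
    rw [one_sub_softmax]
    refine Finset.sum_le_sum fun b _ => ?_
    rw [softmax_eq_exp_sub_mul (x t) b a₁]
    exact mul_le_of_le_one_right (Real.exp_pos _).le (softmax_le_one _ _)
  simpa using hsub.const_sub 1

end Path

/-! ### Exponential supermartingales. -/

/-- If the conditional expectations of `exp (Z s)` given the past are at most `1`, then the partial
sums of `Z` are almost surely bounded above. -/
theorem ae_exists_sum_le_of_condExp_exp_le_one {Ω : Type*} {mΩ : MeasurableSpace Ω}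
    {P : Measure Ω} [IsProbabilityMeasure P] {ℱ : Filtration ℕ mΩ} {Z : ℕ → Ω → ℝ} {B : ℝ}
    (hZ : ∀ s, Measurable[ℱ (s + 1)] (Z s)) (hB : ∀ s, ∀ᵐ ω ∂P, Z s ω ≤ B)
    (hexp : ∀ s, P[fun ω => Real.exp (Z s ω) | ℱ s] ≤ᵐ[P] fun _ => 1) :
    ∀ᵐ ω ∂P, ∃ C, ∀ t, ∑ s ∈ Finset.range t, Z s ω ≤ C := by
  set X : ℕ → Ω → ℝ := fun t ω => Real.exp (∑ s ∈ Finset.range t, Z s ω) with hX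
  have hsum : ∀ t, Measurable[ℱ t] fun ω => ∑ s ∈ Finset.range t, Z s ω := fun t =>
    Finset.measurable_fun_sum _ fun s hs =>
      (hZ s).mono (ℱ.mono (Finset.mem_range.1 hs)) le_rfl
  have hmeas : ∀ t, Measurable[ℱ t] (X t) := fun t => Real.measurable_exp.comp (hsum t)
  have h_int : ∀ t, Integrable (X t) P := by
    intro t
    refine Integrable.of_bound ((hmeas t).mono (ℱ.le t) le_rfl).aestronglyMeasurable
      (Real.exp (t * B)) ?_
    filter_upwards [ae_all_iff.2 hB] with ω hω
    rw [Real.norm_eq_abs, Real.abs_exp, Real.exp_le_exp]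
    calc _ ≤ ∑ s ∈ Finset.range t, B := Finset.sum_le_sum fun s _ => hω s
      _ = _ := by simp
  have hexpint : ∀ s, Integrable (fun ω => Real.exp (Z s ω)) P := by
    intro s
    refine Integrable.of_bound ((Real.measurable_exp.comp (hZ s)).mono
      (ℱ.le (s + 1)) le_rfl).aestronglyMeasurable (Real.exp B) ?_
    filter_upwards [hB s] with ω hω
    rwa [Real.norm_eq_abs, Real.abs_exp, Real.exp_le_exp]
  have hmul : ∀ t, X (t + 1) = X t * fun ω => Real.exp (Z t ω) := by
    intro t
    ext ω
    simp only [hX, Finset.sum_range_succ, Real.exp_add, Pi.mul_apply]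
  have hsuper : Supermartingale X ℱ P := by
    refine supermartingale_nat (fun t => (hmeas t).stronglyMeasurable) h_int fun t => ?_
    have hpull := condExp_mul_of_stronglyMeasurable_left (m := ℱ t) (μ := P)
      (hmeas t).stronglyMeasurable ((hmul t) ▸ h_int (t + 1)) (hexpint t)
    rw [hmul]
    filter_upwards [hpull, hexp t] with ω h1 h2
    rw [h1]
    exact mul_le_of_le_one_right (Real.exp_pos _).le h2
  -- `X` is positive and starts at 1 (the empty sum), so its expectations stay at most 1 and `-X` is
  -- an L¹-bounded submartingale.
  have hbdd : ∀ t, eLpNorm ((-X) t) 1 P ≤ (1 : NNReal) := by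
    intro t
    have h1 : ∫ ω, X t ω ∂P ≤ 1 := by
      have := hsuper.setIntegral_le (Nat.zero_le t) MeasurableSet.univ
      simpa [hX] using this
    rw [Pi.neg_apply, eLpNorm_neg, eLpNorm_one_eq_lintegral_enorm,
      ← ofReal_integral_norm_eq_lintegral_enorm (h_int t)]
    simp only [hX, Real.norm_eq_abs, Real.abs_exp] at h1 ⊢
    simpa using h1
  filter_upwards [hsuper.neg.exists_ae_tendsto_of_bdd hbdd] with ω ⟨c, hc⟩
  obtain ⟨b, hb⟩ := hc.neg.bddAbove_range
  refine ⟨b, fun t => ?_⟩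
  have h1 : X t ω ≤ b := by simpa using hb ⟨t, rfl⟩
  exact (by linarith [Real.add_one_le_exp (∑ s ∈ Finset.range t, Z s ω)] :
    ∑ s ∈ Finset.range t, Z s ω ≤ X t ω).trans h1

/-! ### Conditional moments of the algorithm's increments. -/

lemma measurable_softmax {K : ℕ} (a : Fin K) : Measurable fun y : Fin K → ℝ => softmax y a := by
  unfold softmax
  fun_prop

lemma gradientBanditUpdate_apply {K : ℕ} (η : ℝ) (y : Fin K → ℝ) (b : Fin K) (z : ℝ)
    (a : Fin K) : gradientBanditUpdate η y b z a =
      y a + η * ((if b = a then 1 else 0) - softmax y a) * z := by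
  unfold gradientBanditUpdate
  by_cases h : a = b
  · simp [h]
  · rw [if_neg h, if_neg (Ne.symm h)]
    ring

namespace IsGradientBanditRun

variable {Ω : Type*} {mΩ : MeasurableSpace Ω} {P : Measure Ω} {ℱ : Filtration ℕ mΩ} {K : ℕ} {ν : Fin K → Measure ℝ}
  {Rmax η : ℝ} {θ : ℕ → Ω → Fin K → ℝ} {A : ℕ → Ω → Fin K} {R : ℕ → Ω → ℝ}

lemma measurable_ite_arm (run : IsGradientBanditRun P ℱ ν η θ A R) (t : ℕ) (a : Fin K) :
    Measurable[ℱ (t + 1)] fun ω => if A t ω = a then (1 : ℝ) else 0 :=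
  Measurable.ite (run.measurable_arm t (measurableSet_singleton a)) measurable_const
    measurable_const

lemma measurable_theta (run : IsGradientBanditRun P ℱ ν η θ A R) (t : ℕ) :
    Measurable[ℱ t] (θ t) := by
  induction t with
  | zero => exact run.measurable_init
  | succ t ih =>
    have ih' : Measurable[ℱ (t + 1)] (θ t) := ih.mono (ℱ.mono t.le_succ) le_rfl
    refine @measurable_pi_lambda _ _ _ (ℱ (t + 1)) _ _ fun a => ?_
    simp only [run.update, gradientBanditUpdate_apply]
    have h1 := (measurable_softmax a).comp ih'
    have h2 := (measurable_pi_apply a).comp ih'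
    exact h2.add ((((run.measurable_ite_arm t a).sub h1).const_mul η).mul
      (run.measurable_reward t))

lemma measurable_softmax_theta (run : IsGradientBanditRun P ℱ ν η θ A R) (t : ℕ) (a : Fin K) :
    Measurable[ℱ t] fun ω => softmax (θ t ω) a :=
  (measurable_softmax a).comp (run.measurable_theta t)

lemma measurableSet_arm_reward (run : IsGradientBanditRun P ℱ ν η θ A R) (t : ℕ) (a : Fin K)
    {B : Set ℝ} (hB : MeasurableSet B) : MeasurableSet {ω | A t ω = a ∧ R t ω ∈ B} :=
  ((ℱ.le (t + 1)) _ (run.measurable_arm t (measurableSet_singleton a))).inter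
    ((ℱ.le (t + 1)) _ (run.measurable_reward t hB))

lemma condExp_ite_arm [∀ a, IsProbabilityMeasure (ν a)] (run : IsGradientBanditRun P ℱ ν η θ A R)
    (t : ℕ) (a : Fin K) :
    P[fun ω => if A t ω = a then (1 : ℝ) else 0 | ℱ t] =ᵐ[P] fun ω => softmax (θ t ω) a := by
  have h := run.condLaw t a Set.univ MeasurableSet.univ
  have h2 : ({ω | A t ω = a ∧ R t ω ∈ Set.univ}).indicator (fun _ => (1 : ℝ)) =
      fun ω => if A t ω = a then (1 : ℝ) else 0 := by
    ext ω
    simp [Set.indicator_apply]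
  rw [h2] at h
  simpa using h

variable [IsProbabilityMeasure P]

lemma measureReal_inter (run : IsGradientBanditRun P ℱ ν η θ A R) (t : ℕ) (a : Fin K)
    {B : Set ℝ} (hB : MeasurableSet B) {S : Set Ω} (hS : MeasurableSet[ℱ t] S) :
    P.real ({ω | A t ω = a ∧ R t ω ∈ B} ∩ S) =
      (∫ ω in S, softmax (θ t ω) a ∂P) * (ν a).real B := by
  have hm := run.measurableSet_arm_reward t a hB
  rw [← integral_mul_const, ← setIntegral_congr_ae ((ℱ.le t) _ hS)
    ((run.condLaw t a B hB).mono fun ω h _ => h), setIntegral_condExp (ℱ.le t)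
    ((integrable_const _).indicator hm) hS, integral_indicator hm]
  simp [Measure.restrict_restrict hm]

lemma ae_abs_reward_le (run : IsGradientBanditRun P ℱ ν η θ A R)
    (hν : ∀ a, ∀ᵐ x ∂(ν a), x ∈ Set.Icc (-Rmax) Rmax) (t : ℕ) : ∀ᵐ ω ∂P, |R t ω| ≤ Rmax := by
  have h : ∀ a, ∀ᵐ ω ∂P, ¬ (A t ω = a ∧ R t ω ∈ (Set.Icc (-Rmax) Rmax)ᶜ) := by
    intro a
    have h1 := run.measureReal_inter t a (measurableSet_Icc (a := -Rmax) (b := Rmax)).compl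
      (S := Set.univ) MeasurableSet.univ
    have h2 : (ν a).real (Set.Icc (-Rmax) Rmax)ᶜ = 0 := by
      rw [measureReal_def, show (ν a) (Set.Icc (-Rmax) Rmax)ᶜ = 0 from hν a, ENNReal.toReal_zero]
    rw [h2, mul_zero, Set.inter_univ, measureReal_eq_zero_iff] at h1
    exact measure_eq_zero_iff_ae_notMem.1 h1
  filter_upwards [ae_all_iff.2 h] with ω hω
  rw [abs_le]
  by_contra hc
  exact hω (A t ω) ⟨rfl, hc⟩

lemma integrable_reward (run : IsGradientBanditRun P ℱ ν η θ A R)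
    (hν : ∀ a, ∀ᵐ x ∂(ν a), x ∈ Set.Icc (-Rmax) Rmax) (t : ℕ) : Integrable (R t) P :=
  Integrable.of_bound ((run.measurable_reward t).mono (ℱ.le _) le_rfl).aestronglyMeasurable Rmax
    (run.ae_abs_reward_le hν t)

lemma integrable_ite_arm_mul_reward (run : IsGradientBanditRun P ℱ ν η θ A R)
    (hν : ∀ a, ∀ᵐ x ∂(ν a), x ∈ Set.Icc (-Rmax) Rmax) (t : ℕ) (a : Fin K) :
    Integrable (fun ω => (if A t ω = a then 1 else 0) * R t ω) P := by
  refine (run.integrable_reward hν t).mono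
    ((((run.measurable_ite_arm t a).mul (run.measurable_reward t)).mono
      (ℱ.le _) le_rfl).aestronglyMeasurable) (Eventually.of_forall fun ω => ?_)
  split_ifs <;> simp

lemma ae_abs_increment_le (run : IsGradientBanditRun P ℱ ν η θ A R)
    (hν : ∀ a, ∀ᵐ x ∂(ν a), x ∈ Set.Icc (-Rmax) Rmax) (t : ℕ) :
    ∀ᵐ ω ∂P, ∀ a, |θ (t + 1) ω a - θ t ω a| ≤ |η| * Rmax := by
  filter_upwards [run.ae_abs_reward_le hν t] with ω hω a
  have h0 := softmax_pos (θ t ω) a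
  have h1 := softmax_le_one (θ t ω) a
  rw [run.update, gradientBanditUpdate_apply, add_sub_cancel_left, mul_assoc, abs_mul, abs_mul]
  refine mul_le_mul_of_nonneg_left ((mul_le_of_le_one_left (abs_nonneg _) ?_).trans hω)
    (abs_nonneg _)
  rw [abs_le]
  split_ifs <;> constructor <;> linarith

lemma ae_abs_mul_increment_le_one (run : IsGradientBanditRun P ℱ ν η θ A R)
    (hν : ∀ a, ∀ᵐ x ∂(ν a), x ∈ Set.Icc (-Rmax) Rmax) {l : ℝ} (hl : |l * η| * Rmax ≤ 1)
    (t : ℕ) (a : Fin K) : ∀ᵐ ω ∂P, |l * (θ (t + 1) ω a - θ t ω a)| ≤ 1 := by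
  filter_upwards [run.ae_abs_increment_le hν t] with ω hω
  refine hl.trans' ?_
  rw [abs_mul, abs_mul, mul_assoc]
  exact mul_le_mul_of_nonneg_left (hω a) (abs_nonneg _)

lemma integrable_softmax (run : IsGradientBanditRun P ℱ ν η θ A R) (t : ℕ) (a : Fin K) :
    Integrable (fun ω => softmax (θ t ω) a) P :=
  Integrable.of_bound ((run.measurable_softmax_theta t a).mono (ℱ.le _) le_rfl).aestronglyMeasurable
    1 (Eventually.of_forall fun ω => by
      rw [Real.norm_eq_abs, abs_of_pos (softmax_pos _ _)]
      exact softmax_le_one _ _)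

variable [∀ a, IsProbabilityMeasure (ν a)]

lemma condExp_ite_arm_mul_reward (run : IsGradientBanditRun P ℱ ν η θ A R)
    (hν : ∀ a, ∀ᵐ x ∂(ν a), x ∈ Set.Icc (-Rmax) Rmax) (t : ℕ) (a : Fin K) :
    P[fun ω => (if A t ω = a then 1 else 0) * R t ω | ℱ t] =ᵐ[P]
      fun ω => softmax (θ t ω) a * meanReward ν a := by
  symm
  refine ae_eq_condExp_of_forall_setIntegral_eq (ℱ.le t)
    (run.integrable_ite_arm_mul_reward hν t a)
    (fun S _ _ => ((run.integrable_softmax t a).mul_const _).integrableOn) (fun S hS _ => ?_)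
    ((run.measurable_softmax_theta t a).mul_const _).aestronglyMeasurable
  have hS' := (ℱ.le t) _ hS
  have hA : MeasurableSet {ω | A t ω = a} :=
    (ℱ.le (t + 1)) _ (run.measurable_arm t (measurableSet_singleton a))
  have hR : Measurable (R t) := (run.measurable_reward t).mono (ℱ.le _) le_rfl
  set q := ∫ ω in S, softmax (θ t ω) a ∂P with hq
  have hq0 : 0 ≤ q := integral_nonneg fun ω => (softmax_pos _ _).le
  -- On an event of the past intersected with a pull of `a`, the reward has law `ν a` up to total
  -- mass; this passes from sets to the mean.
  have hmap : (P.restrict ({ω | A t ω = a} ∩ S)).map (R t) = ENNReal.ofReal q • ν a := by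
    ext B hB
    have h := run.measureReal_inter t a hB hS
    rw [Measure.map_apply hR hB, Measure.restrict_apply (hR hB), Measure.smul_apply, smul_eq_mul,
      ← ofReal_measureReal (μ := ν a), ← ENNReal.ofReal_mul hq0, ← h, ofReal_measureReal]
    congr 1
    ext ω
    simp only [Set.mem_inter_iff, Set.mem_preimage, Set.mem_ofPred_eq]
    tauto
  have h_int : ∫ ω in {ω | A t ω = a} ∩ S, R t ω ∂P = q * meanReward ν a := by
    have h := integral_map (μ := P.restrict ({ω | A t ω = a} ∩ S)) hR.aemeasurable
      (f := fun z : ℝ => z) aestronglyMeasurable_id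
    rw [← h, hmap, integral_smul_measure, ENNReal.toReal_ofReal hq0, smul_eq_mul, meanReward]
  rw [integral_mul_const, ← hq, ← h_int, ← Measure.restrict_restrict hA, ← integral_indicator hA]
  refine integral_congr_ae (Eventually.of_forall fun ω => ?_)
  simp [Set.indicator_apply]

lemma condExp_reward (run : IsGradientBanditRun P ℱ ν η θ A R)
    (hν : ∀ a, ∀ᵐ x ∂(ν a), x ∈ Set.Icc (-Rmax) Rmax) (t : ℕ) :
    P[R t | ℱ t] =ᵐ[P] fun ω => ∑ b, softmax (θ t ω) b * meanReward ν b := by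
  have hsum : R t = ∑ b, fun ω => (if A t ω = b then 1 else 0) * R t ω := by
    ext ω
    simp
  rw [hsum]
  refine (condExp_finsetSum (fun b _ => run.integrable_ite_arm_mul_reward hν t b) _).trans ?_
  filter_upwards [ae_all_iff.2 fun b => run.condExp_ite_arm_mul_reward hν t b] with ω hω
  simp only [Finset.sum_apply, hω]

/-- The conditional moment generating function of an increment is at most one plus the drift and
the variance proxy. -/
lemma condExp_exp_increment_le (run : IsGradientBanditRun P ℱ ν η θ A R)
    (hν : ∀ a, ∀ᵐ x ∂(ν a), x ∈ Set.Icc (-Rmax) Rmax) {l : ℝ} (hl : |l * η| * Rmax ≤ 1)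
    (t : ℕ) (a : Fin K) :
    P[fun ω => Real.exp (l * (θ (t + 1) ω a - θ t ω a)) | ℱ t] ≤ᵐ[P] fun ω =>
      1 + (l * (η * (softmax (θ t ω) a *
        (meanReward ν a - ∑ b, softmax (θ t ω) b * meanReward ν b))) +
        (l * η * Rmax) ^ 2 * (softmax (θ t ω) a * (1 - softmax (θ t ω) a))) := by
  set p : Ω → ℝ := fun ω => softmax (θ t ω) a with hp
  set u : Ω → ℝ := fun ω => if A t ω = a then 1 else 0 with hu
  have hpm : Measurable[ℱ t] p := run.measurable_softmax_theta t a
  have hp0 : ∀ ω, 0 ≤ p ω := fun ω => (softmax_pos _ _).le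
  have hp1 : ∀ ω, p ω ≤ 1 := fun ω => softmax_le_one _ _
  have hum : Measurable u := (run.measurable_ite_arm t a).mono (ℱ.le _) le_rfl
  have hui : Integrable u P := Integrable.of_bound hum.aestronglyMeasurable 1
    (Eventually.of_forall fun ω => by simp only [hu]; split_ifs <;> simp)
  have hRi := run.integrable_reward hν t
  have huRi : Integrable (u * R t) P := run.integrable_ite_arm_mul_reward hν t a
  have hΔ : ∀ ω, l * (θ (t + 1) ω a - θ t ω a) = l * η * ((u ω - p ω) * R t ω) := by
    intro ω
    rw [run.update, gradientBanditUpdate_apply]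
    simp only [hu, hp]
    ring
  have hu01 : ∀ ω, u ω = 0 ∨ u ω = 1 := fun ω => by
    simp only [hu]
    split_ifs <;> simp
  have hsmall := run.ae_abs_mul_increment_le_one hν hl t a
  have hexpi : Integrable (fun ω => Real.exp (l * (θ (t + 1) ω a - θ t ω a))) P := by
    have hm : ∀ s, Measurable fun ω => θ s ω a := fun s =>
      (measurable_pi_apply a).comp ((run.measurable_theta s).mono (ℱ.le s) le_rfl)
    refine Integrable.of_bound (Real.measurable_exp.comp
      (((hm (t + 1)).sub (hm t)).const_mul l)).aestronglyMeasurable (Real.exp 1) ?_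
    filter_upwards [hsmall] with ω hω
    rw [Real.norm_eq_abs, Real.abs_exp, Real.exp_le_exp]
    exact (le_abs_self _).trans hω
  -- The bound is e^z ≤ 1 + z + z² for |z| ≤ 1. Since u² = u, (u − p)² is affine in u, so the
  -- majorant `W` is a combination of 1, uR, R and u with coefficients known at time t.
  set f₀ : Ω → ℝ := fun ω => 1 + (l * η * Rmax) ^ 2 * p ω ^ 2 with hf₀
  set f₁ : Ω → ℝ := fun ω => -(l * η) * p ω with hf₁
  set f₂ : Ω → ℝ := fun ω => (l * η * Rmax) ^ 2 * (1 - 2 * p ω) with hf₂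
  have hf₀m : Measurable[ℱ t] f₀ := ((hpm.pow_const 2).const_mul _).const_add 1
  have hf₁m : Measurable[ℱ t] f₁ := hpm.const_mul _
  have hf₂m : Measurable[ℱ t] f₂ := ((hpm.const_mul 2).const_sub 1).const_mul _
  have hf₁b : ∀ᵐ ω ∂P, ‖f₁ ω‖ ≤ |l * η| := Eventually.of_forall fun ω => by
    rw [Real.norm_eq_abs, hf₁, abs_mul, abs_neg, abs_of_nonneg (hp0 ω)]
    exact mul_le_of_le_one_right (abs_nonneg _) (hp1 ω)
  have hf₂b : ∀ᵐ ω ∂P, ‖f₂ ω‖ ≤ (l * η * Rmax) ^ 2 := Eventually.of_forall fun ω => by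
    rw [Real.norm_eq_abs, hf₂, abs_mul, abs_of_nonneg (sq_nonneg _)]
    refine mul_le_of_le_one_right (sq_nonneg _) (abs_le.2 ⟨?_, ?_⟩) <;>
      linarith [hp0 ω, hp1 ω]
  have hf₀i : Integrable f₀ P := by
    refine Integrable.of_bound (hf₀m.mono (ℱ.le t) le_rfl).aestronglyMeasurable
      (1 + (l * η * Rmax) ^ 2) (Eventually.of_forall fun ω => ?_)
    have h1 : 0 ≤ f₀ ω := by positivity
    rw [Real.norm_eq_abs, abs_of_nonneg h1]
    have h2 : p ω ^ 2 ≤ 1 := pow_le_one₀ (hp0 ω) (hp1 ω)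
    have := mul_le_of_le_one_right (sq_nonneg (l * η * Rmax)) h2
    simp only [hf₀]
    linarith
  have hf₁i : Integrable (f₁ * R t) P :=
    hRi.bdd_mul (hf₁m.mono (ℱ.le t) le_rfl).aestronglyMeasurable hf₁b
  have hf₂i : Integrable (f₂ * u) P :=
    hui.bdd_mul (hf₂m.mono (ℱ.le t) le_rfl).aestronglyMeasurable hf₂b
  set W : Ω → ℝ := f₀ + (l * η) • (u * R t) + f₁ * R t + f₂ * u with hW
  have hWi : Integrable W P := ((hf₀i.add (huRi.smul (l * η))).add hf₁i).add hf₂i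
  have hle : (fun ω => Real.exp (l * (θ (t + 1) ω a - θ t ω a))) ≤ᵐ[P] W := by
    filter_upwards [hsmall, run.ae_abs_reward_le hν t] with ω h1 h2
    have h3 := (abs_le.1 (Real.abs_exp_sub_one_sub_id_le h1)).2
    have h4 : (l * (θ (t + 1) ω a - θ t ω a)) ^ 2 ≤
        (l * η * Rmax) ^ 2 * (u ω - p ω) ^ 2 := by
      rw [hΔ]
      have h5 : R t ω ^ 2 ≤ Rmax ^ 2 := sq_le_sq' (abs_le.1 h2).1 (abs_le.1 h2).2
      calc _ = (l * η * (u ω - p ω)) ^ 2 * R t ω ^ 2 := by ring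
        _ ≤ (l * η * (u ω - p ω)) ^ 2 * Rmax ^ 2 := by gcongr
        _ = _ := by ring
    have h6 : (u ω - p ω) ^ 2 = u ω * (1 - 2 * p ω) + p ω ^ 2 := by
      rcases hu01 ω with h | h <;> rw [h] <;> ring
    rw [h6] at h4
    have h7 := hΔ ω
    simp only [hW, hf₀, hf₁, hf₂, Pi.add_apply, Pi.smul_apply, Pi.mul_apply, smul_eq_mul]
    linarith
  have hc := condExp_add ((hf₀i.add (huRi.smul (l * η))).add hf₁i) hf₂i (ℱ t)
  have hc' := condExp_add (hf₀i.add (huRi.smul (l * η))) hf₁i (ℱ t)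
  have hc'' := condExp_add hf₀i (huRi.smul (l * η)) (ℱ t)
  have e₀ := condExp_of_stronglyMeasurable (ℱ.le t) hf₀m.stronglyMeasurable hf₀i
  have e₁ := condExp_smul (μ := P) (l * η) (u * R t) (ℱ t)
  have e₂ := condExp_stronglyMeasurable_mul_of_bound (ℱ.le t) hf₁m.stronglyMeasurable hRi _ hf₁b
  have e₃ := condExp_stronglyMeasurable_mul_of_bound (ℱ.le t) hf₂m.stronglyMeasurable hui _ hf₂b
  have e₄ : P[u * R t | ℱ t] =ᵐ[P] _ := run.condExp_ite_arm_mul_reward hν t a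
  filter_upwards [condExp_mono (m := ℱ t) hexpi hWi hle, hc, hc', hc'', e₁, e₂, e₃, e₄,
    run.condExp_reward hν t, run.condExp_ite_arm t a] with ω h h₁ h₂ h₃ h₄ h₅ h₆ h₇ h₈ h₉
  refine h.trans (le_of_eq ?_)
  rw [h₁, Pi.add_apply, h₂, Pi.add_apply, h₃, Pi.add_apply, e₀, h₄, h₅, h₆, Pi.smul_apply, h₇,
    Pi.mul_apply, h₈, Pi.mul_apply, h₉]
  simp only [hf₀, hf₁, hf₂, hp, smul_eq_mul]
  ring

/-! ### From conditional moments to almost sure drift control. -/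

/-- One-sided control of a coordinate by its drift and variance proxy. -/
lemma ae_exists_increment_le (run : IsGradientBanditRun P ℱ ν η θ A R)
    (hν : ∀ a, ∀ᵐ x ∂(ν a), x ∈ Set.Icc (-Rmax) Rmax) {l : ℝ} (hl : |l * η| * Rmax ≤ 1)
    (a : Fin K) : ∀ᵐ ω ∂P, ∃ C, ∀ t, l * (θ t ω a - ∑ s ∈ Finset.range t,
      η * (softmax (θ s ω) a *
        (meanReward ν a - ∑ b, softmax (θ s ω) b * meanReward ν b))) ≤
      C + (l * η * Rmax) ^ 2 *
        ∑ s ∈ Finset.range t, softmax (θ s ω) a * (1 - softmax (θ s ω) a) := by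
  set k : ℕ → Ω → ℝ := fun s ω => l * (η * (softmax (θ s ω) a *
    (meanReward ν a - ∑ b, softmax (θ s ω) b * meanReward ν b))) +
    (l * η * Rmax) ^ 2 * (softmax (θ s ω) a * (1 - softmax (θ s ω) a)) with hk
  set Z : ℕ → Ω → ℝ := fun s ω => l * (θ (s + 1) ω a - θ s ω a) - k s ω with hZ
  have hkm : ∀ s, Measurable[ℱ s] (k s) := by
    intro s
    have h := run.measurable_softmax_theta s
    refine Measurable.add ((((h a).mul (Measurable.const_sub
      (Finset.measurable_fun_sum _ fun b _ => (h b).mul_const _) _)).const_mul η).const_mul l) ?_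
    exact ((h a).mul ((h a).const_sub 1)).const_mul _
  have hxm : ∀ s, Measurable[ℱ s] fun ω => θ s ω a := fun s =>
    (measurable_pi_apply a).comp (run.measurable_theta s)
  have hinc : ∀ s, Measurable[ℱ (s + 1)] fun ω => l * (θ (s + 1) ω a - θ s ω a) := fun s =>
    ((hxm (s + 1)).sub ((hxm s).mono (ℱ.mono s.le_succ) le_rfl)).const_mul l
  have hZm : ∀ s, Measurable[ℱ (s + 1)] (Z s) := fun s =>
    (hinc s).sub ((hkm s).mono (ℱ.mono s.le_succ) le_rfl)
  obtain ⟨D, hD0, hD⟩ := exists_spread (meanReward ν)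
  have hincB : ∀ s, ∀ᵐ ω ∂P, l * (θ (s + 1) ω a - θ s ω a) ≤ 1 := fun s =>
    (run.ae_abs_mul_increment_le_one hν hl s a).mono fun ω hω => (le_abs_self _).trans hω
  have hkB : ∀ s ω, -(|l * η| * D) ≤ k s ω := by
    intro s ω
    have h0 := softmax_pos (θ s ω) a
    have h1 := softmax_le_one (θ s ω) a
    have h2 : |softmax (θ s ω) a *
        (meanReward ν a - ∑ b, softmax (θ s ω) b * meanReward ν b)| ≤ D := by
      rw [abs_mul, abs_of_pos h0]
      refine (mul_le_of_le_one_left (abs_nonneg _) h1).trans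
        ((abs_sub_sum_softmax_mul_le hD (θ s ω) a).trans (mul_le_of_le_one_right hD0 ?_))
      linarith
    have h3 := neg_abs_le (l * η * (softmax (θ s ω) a *
      (meanReward ν a - ∑ b, softmax (θ s ω) b * meanReward ν b)))
    rw [abs_mul (l * η)] at h3
    have h4 := mul_le_mul_of_nonneg_left h2 (abs_nonneg (l * η))
    have h5 := mul_nonneg (sq_nonneg (l * η * Rmax)) (softmax_mul_one_sub_nonneg (θ s ω) a)
    simp only [hk]
    linarith
  have hZB : ∀ s, ∀ᵐ ω ∂P, Z s ω ≤ 1 + |l * η| * D := fun s => by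
    filter_upwards [hincB s] with ω hω
    simp only [hZ]
    linarith [hkB s ω]
  -- As `k s` is known at time s, the conditional expectation is at most (1 + k)e^{−k} ≤ 1.
  have hexp : ∀ s, P[fun ω => Real.exp (Z s ω) | ℱ s] ≤ᵐ[P] fun _ => 1 := by
    intro s
    have hsplit : (fun ω => Real.exp (Z s ω)) = (fun ω => Real.exp (-k s ω)) *
        fun ω => Real.exp (l * (θ (s + 1) ω a - θ s ω a)) := by
      ext ω
      rw [Pi.mul_apply, ← Real.exp_add]
      simp only [hZ]
      ring_nf
    have hi : Integrable (fun ω => Real.exp (l * (θ (s + 1) ω a - θ s ω a))) P := by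
      refine Integrable.of_bound ((Real.measurable_exp.comp (hinc s)).mono
        (ℱ.le _) le_rfl).aestronglyMeasurable (Real.exp 1) ?_
      filter_upwards [hincB s] with ω hω
      rwa [Real.norm_eq_abs, Real.abs_exp, Real.exp_le_exp]
    have hpull := condExp_stronglyMeasurable_mul_of_bound (μ := P) (ℱ.le s)
      (Real.measurable_exp.comp (hkm s).neg).stronglyMeasurable hi (Real.exp (|l * η| * D))
      (Eventually.of_forall fun ω => by
        rw [Real.norm_eq_abs, Function.comp, Real.abs_exp, Real.exp_le_exp]
        simpa using neg_le.1 (hkB s ω))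
    rw [hsplit]
    filter_upwards [hpull, run.condExp_exp_increment_le hν hl s a] with ω h1 h2
    refine h1.le.trans ?_
    calc Real.exp (-k s ω) * _ ≤ Real.exp (-k s ω) * Real.exp (k s ω) := by
          refine mul_le_mul_of_nonneg_left (h2.trans ?_) (Real.exp_pos _).le
          rw [add_comm]
          exact Real.add_one_le_exp _
      _ = 1 := by rw [← Real.exp_add]; simp
  filter_upwards [ae_exists_sum_le_of_condExp_exp_le_one hZm hZB hexp] with ω ⟨C, hC⟩
  refine ⟨C + l * θ 0 ω a, fun t => ?_⟩
  have h := hC t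
  simp only [hZ, hk, Finset.sum_sub_distrib, Finset.sum_add_distrib, ← Finset.mul_sum,
    Finset.sum_range_sub (fun s => θ s ω a)] at h
  simp only [← Finset.mul_sum]
  linarith

theorem ae_followsDrift (run : IsGradientBanditRun P ℱ ν η θ A R) (hRmax : 0 < Rmax)
    (hη : 0 < η) (hν : ∀ a, ∀ᵐ x ∂(ν a), x ∈ Set.Icc (-Rmax) Rmax) :
    ∀ᵐ ω ∂P, FollowsDrift η (meanReward ν) fun t => θ t ω := by
  -- With this l, lηRmax = 1/(n + 1) ≤ 1, and after division by l the variance coefficient is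
  -- ηRmax/(n + 1), which falls below any ε. Countably many l suffice, and both signs give the
  -- two-sided bound.
  have hpos : ∀ n : ℕ, 0 < 1 / ((n + 1 : ℝ) * (η * Rmax)) := fun n => by positivity
  have hl : ∀ n : ℕ, |1 / ((n + 1 : ℝ) * (η * Rmax)) * η| * Rmax ≤ 1 := by
    intro n
    rw [abs_of_pos (mul_pos (hpos n) hη)]
    have : 1 / ((n + 1 : ℝ) * (η * Rmax)) * η * Rmax = 1 / (n + 1) := by field_simp
    rw [this, div_le_one (by positivity)]
    linarith [n.cast_nonneg (α := ℝ)]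
  have hl' : ∀ n : ℕ, |-(1 / ((n + 1 : ℝ) * (η * Rmax))) * η| * Rmax ≤ 1 := by
    intro n
    rw [neg_mul, abs_neg]
    exact hl n
  filter_upwards [ae_all_iff.2 fun a => ae_all_iff.2 fun n =>
      run.ae_exists_increment_le hν (hl n) a,
    ae_all_iff.2 fun a => ae_all_iff.2 fun n => run.ae_exists_increment_le hν (hl' n) a]
    with ω h₁ h₂ a ε hε
  obtain ⟨n, hn⟩ := exists_nat_one_div_lt (div_pos hε (mul_pos hη hRmax))
  obtain ⟨C₁, hC₁⟩ := h₁ a n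
  obtain ⟨C₂, hC₂⟩ := h₂ a n
  have hn0 := hpos n
  set l := 1 / ((n + 1 : ℝ) * (η * Rmax)) with hldef
  have hlε : (l * η * Rmax) ^ 2 ≤ l * ε := by
    have h3 : l * η * Rmax = 1 / (n + 1) := by rw [hldef]; field_simp
    have h4 : 1 / ((n : ℝ) + 1) * (η * Rmax) ≤ ε := ((lt_div_iff₀ (by positivity)).1 hn).le
    calc (l * η * Rmax) ^ 2 = l * (1 / (n + 1) * (η * Rmax)) := by
          rw [sq]
          nth_rw 2 [h3]
          ring
      _ ≤ l * ε := by gcongr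
  refine ⟨max C₁ C₂ / l, fun t => ?_⟩
  have hV : 0 ≤ ∑ s ∈ Finset.range t, softmax (θ s ω) a * (1 - softmax (θ s ω) a) :=
    Finset.sum_nonneg fun s _ => softmax_mul_one_sub_nonneg _ _
  have hVle := mul_le_mul_of_nonneg_right hlε hV
  have h5 := hC₁ t
  have h6 := hC₂ t
  rw [neg_mul, neg_mul, neg_mul, neg_sq] at h6
  have hm : l * (max C₁ C₂ / l) = max C₁ C₂ := by field_simp
  have hm1 := le_max_left C₁ C₂
  have hm2 := le_max_right C₁ C₂
  rw [abs_le]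
  constructor <;> refine le_of_mul_le_mul_left ?_ hn0 <;> linarith

end IsGradientBanditRun

theorem theorem2 {Ω : Type*} {mΩ : MeasurableSpace Ω} (P : Measure Ω) [IsProbabilityMeasure P]
    (ℱ : Filtration ℕ mΩ) {K : ℕ} (hK : 2 ≤ K)
    (ν : Fin K → Measure ℝ) [∀ a, IsProbabilityMeasure (ν a)]
    (Rmax : ℝ) (hRmax : 0 < Rmax) (hν : ∀ a, ∀ᵐ x ∂(ν a), x ∈ Set.Icc (-Rmax) Rmax)
    (no_ties : ∀ i j : Fin K, i ≠ j → meanReward ν i ≠ meanReward ν j)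
    (η : ℝ) (hη : 0 < η)
    (θ : ℕ → Ω → Fin K → ℝ) (A : ℕ → Ω → Fin K) (R : ℕ → Ω → ℝ)
    (run : IsGradientBanditRun P ℱ ν η θ A R)
    (astar : Fin K) (optimal : ∀ a, meanReward ν a ≤ meanReward ν astar) :
    ∀ᵐ ω ∂P, Tendsto (fun t => softmax (θ t ω) astar) atTop (𝓝 1) := by
  filter_upwards [run.ae_followsDrift hRmax hη hν,
    ae_all_iff.2 (run.ae_abs_increment_le hν)] with ω h hω
  exact h.tendsto_softmax hη (fun i j hij => by_contra fun hne => no_ties i j hne hij) hω optimal
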